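/- Let $M_2$ be the algebra of complex $2\times2$ matrices, and let $(\mathcal T_t)_{t\ge 0}$ be a quantum Markov semigroup on $M_2$, i.e. a $w^*$-continuous one-parameter semigroup of completely positive linear maps on $M_2$ with $\mathcal T_0=\mathrm{id}$ and $\mathcal T_t(I)=I$. For $\rho\in M_2$ put $\omega_\rho(x)=\operatorname{tr}(\rho x)$, and let $(\tilde{\mathcal T}_{*t})$ be the predual semigroup on $M_2$, defined by $\operatorname{tr}(\tilde{\mathcal T}_{*t}(\rho)x)=\operatorname{tr}(\rho\,\mathcal T_t(x))$ for all $\rho,x\in M_2$. Let $e_1,e_2$ be orthonormal vectors in $\mathbb C^2$ and suppose that the pure state $\omega_{|e_1\rangle\langle e_1|}$ is absorbing, i.e. $\lim_{t\to\infty}\omega(\mathcal T_t(x))=\omega_{|e_1\rangle\langle e_1|}(x)$ for every state $\omega$ on $M_2$ and every $x\in M_2$. Then there exist $y,z_1,z_2\in M_2$ with $$ye_1=y^*e_1=z_1e_1=z_2e_1=0$$ such that the generator $\tilde{\mathcal L}_*$ of $(\tilde{\mathcal T}_{*t})$ has the form $$\tilde{\mathcal L}_*(\rho)=y\rho+\rho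 y^*+\mathcal J(\rho),\qquad \mathcal J(\rho)=z_1\rho z_1^*+z_2\rho z_2^*\qquad(\rho\in M_2).$$ For any such $y,z_1,z_2$, let $\eta$ be the greatest eigenvalue of $-(y+y^*)$, let $a=|\langle z_1e_2,e_2\rangle|^2+|\langle z_2e_2,e_2\rangle|^2$, and let $\mathcal J^*$ be the adjoint of $\mathcal J$, i.e. $\operatorname{tr}(\mathcal J^*(x)\rho)=\operatorname{tr}(x\,\mathcal J(\rho))$ for all $x,\rho\in M_2$. Then: (a) $\mathcal J^*(|e_1\rangle\langle e_1|)=(\eta-a)\,|e_2\rangle\langle e_2|$. (b) For every state $\omega\ne\omega_{|e_1\rangle\langle e_1|}$ on $M_2$ and every projection $p\in M_2\setminus\{0\}$, one has $\omega(\mathcal T_t(p))>0$ for all sufficiently large $t$, and $$\lim_{t\to\infty}\frac1t\log\omega(\mathcal T_t(p))=\begin{cases}a-\eta&\text{if }p=|e_2\rangle\langle e_2|,\\0&\text{otherwise.}\end{cases}$$ -/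

import Mathlib

open Filter Topology
open scoped Matrix NNReal ComplexOrder MatrixOrder Matrix.Norms.L2Operator CStarAlgebra

namespace QuantumMarkov

/-- The algebra of complex `2 × 2` matrices (a C⋆-algebra with the Loewner order). -/
abbrev M₂ : Type := Matrix (Fin 2) (Fin 2) ℂ

/-- A quantum Markov semigroup on `M₂`: a weak-⋆ continuous one-parameter semigroup of
identity-preserving completely positive linear maps. Since `M₂` is finite dimensional, its predual
consists of all linear functionals. -/
structure QuantumMarkovSemigroup where
  /-- The map at time `t`. -/
  map : ℝ≥0 → (M₂ →CP M₂)
  map_zero : ∀ x, map 0 x = x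
  map_add : ∀ s t x, map (s + t) x = map s (map t x)
  map_one : ∀ t, map t 1 = 1
  weakStar_continuous : ∀ (φ : M₂ →ₗ[ℂ] ℂ) (x : M₂), Continuous fun t => φ (map t x)

/-- The map at time `t` as a plain linear map. -/
def QuantumMarkovSemigroup.lin (T : QuantumMarkovSemigroup) (t : ℝ≥0) : M₂ →ₗ[ℂ] M₂ :=
  (T.map t).toLinearMap

/-- A state on `M₂`: a positive linear functional with value `1` at the identity. -/
structure IsState (ω : M₂ →ₗ[ℂ] ℂ) : Prop where
  nonneg : ∀ x, 0 ≤ x → 0 ≤ ω x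
  map_one : ω 1 = 1

/-- The action `ω ↦ ω ∘ T_t` of the predual semigroup on functionals. -/
def QuantumMarkovSemigroup.predual (T : QuantumMarkovSemigroup) (t : ℝ≥0)
    (ω : M₂ →ₗ[ℂ] ℂ) : M₂ →ₗ[ℂ] ℂ :=
  ω ∘ₗ T.lin t

/-- The functional `x ↦ tr (ρ x)` given by `ρ`. -/
def functionalOf (ρ : M₂) : M₂ →ₗ[ℂ] ℂ :=
  Matrix.traceLinearMap (Fin 2) ℂ ℂ ∘ₗ LinearMap.mulLeft ℂ ρ

/-- The operator `|e⟩⟨e|`. -/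
def ketBra (e : Fin 2 → ℂ) : M₂ := Matrix.vecMulVec e (star e)

/-- `ω∞` is an absorbing state: `ω ∘ T_t → ω∞` (weak-⋆) for every state `ω`. -/
def QuantumMarkovSemigroup.IsAbsorbing (T : QuantumMarkovSemigroup)
    (ωinf : M₂ →ₗ[ℂ] ℂ) : Prop :=
  IsState ωinf ∧ ∀ ω, IsState ω → ∀ x, Tendsto (fun t => T.predual t ω x) atTop (𝓝 (ωinf x))

/-- The adjoint of a linear map on `M₂` for the trace duality `(ρ, x) ↦ tr (ρ x)`; see
`trace_traceDual_mul`. -/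
def traceDual (Φ : M₂ →ₗ[ℂ] M₂) : M₂ →ₗ[ℂ] M₂ where
  toFun ρ := Matrix.of fun i j => (ρ * Φ (Matrix.single j i 1)).trace
  map_add' ρ σ := by
    ext i j
    simp [add_mul]
  map_smul' c ρ := by
    ext i j
    simp

theorem trace_traceDual_mul (Φ : M₂ →ₗ[ℂ] M₂) (ρ x : M₂) :
    (traceDual Φ ρ * x).trace = (ρ * Φ x).trace := by
  have hx : Φ x = ∑ i, ∑ j, x i j • Φ (Matrix.single i j 1) := by
    conv_lhs => rw [Matrix.matrix_eq_sum_single x]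
    simp only [map_sum]
    refine Finset.sum_congr rfl fun i _ => Finset.sum_congr rfl fun j _ => ?_
    rw [← map_smul, Matrix.smul_single, smul_eq_mul, mul_one]
  rw [hx]
  simp only [Finset.mul_sum, Matrix.trace_sum, Matrix.mul_smul, Matrix.trace_smul, smul_eq_mul]
  rw [Finset.sum_comm]
  simp only [Matrix.trace, Matrix.diag_apply, Matrix.mul_apply (M := traceDual Φ ρ)]
  refine Finset.sum_congr rfl fun i _ => Finset.sum_congr rfl fun j _ => ?_
  simp [traceDual, Matrix.trace, mul_comm]

/-- The predual semigroup transported to `M₂` by identifying `ρ` with `functionalOf ρ`; see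
`functionalOf_predualMap`. -/
def QuantumMarkovSemigroup.predualMap (T : QuantumMarkovSemigroup) (t : ℝ≥0) : M₂ →ₗ[ℂ] M₂ :=
  traceDual (T.lin t)

theorem functionalOf_predualMap (T : QuantumMarkovSemigroup) (t : ℝ≥0) (ρ : M₂) :
    functionalOf (T.predualMap t ρ) = T.predual t (functionalOf ρ) := by
  ext1 x
  exact trace_traceDual_mul (T.lin t) ρ x

/-- `L` is the infinitesimal generator of the family `S` of linear maps on `M₂`. -/
def IsGenerator (S : ℝ≥0 → M₂ →ₗ[ℂ] M₂) (L : M₂ → M₂) : Prop :=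
  ∀ ρ, Tendsto (fun t : ℝ≥0 => (t : ℝ)⁻¹ • (S t ρ - ρ)) (𝓝[>] 0) (𝓝 (L ρ))

/-- The completely positive map `ρ ↦ z₁ ρ z₁* + z₂ ρ z₂*`. -/
def jumpMap (z : Fin 2 → M₂) : M₂ →ₗ[ℂ] M₂ :=
  ∑ i, LinearMap.mulRight ℂ (z i)ᴴ ∘ₗ LinearMap.mulLeft ℂ (z i)

/-- `y, z₁, z₂` are parameters of the generator of the predual semigroup, adapted to the
stationary pure state given by the unit vector `e`. -/
structure IsGeneratorParam (T : QuantumMarkovSemigroup) (e : Fin 2 → ℂ)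
    (y : M₂) (z : Fin 2 → M₂) : Prop where
  generator : IsGenerator T.predualMap fun ρ => y * ρ + ρ * yᴴ + jumpMap z ρ
  y_mulVec : y *ᵥ e = 0
  y_conjTranspose_mulVec : yᴴ *ᵥ e = 0
  z_mulVec : ∀ i, z i *ᵥ e = 0

/-- `a = |⟨z₁ e₂, e₂⟩|² + |⟨z₂ e₂, e₂⟩|²`. -/
noncomputable def rateA (z : Fin 2 → M₂) (e₂ : Fin 2 → ℂ) : ℝ :=
  ∑ i, ‖star (z i *ᵥ e₂) ⬝ᵥ e₂‖ ^ 2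

/-- `η` is the greatest eigenvalue of `-(y + y*)`. -/
def IsRateEta (y : M₂) (η : ℝ) : Prop :=
  IsGreatest {r : ℝ | Module.End.HasEigenvalue (Matrix.toLin' (-(y + yᴴ))) (r : ℂ)} η

end QuantumMarkov

open QuantumMarkov

namespace QuantumMarkov

/-! Write `E_ij = |e_i⟩⟨e_j|`. An absorbing state is stationary, so the predual maps fix `E₁₁`. The
entry `⟨e₂, E₁₁ e₂⟩` vanishes, so complete positivity and trace preservation force `E₂₁ ↦ w(t) E₂₁`
and `E₂₂ ↦ R(t)` with `R(t) ≥ |w(t)|² E₂₂`. With `κ = w'(0)`, differentiating at `0` shows that `C =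
L(E₂₂) - (κ + κ̄) E₂₂` is positive. A factorization `C = |v₁⟩⟨v₁| + |v₂⟩⟨v₂|` gives `y = κ E₂₂` and
`z_i = |v_i⟩⟨e₂|` (`exists_isGeneratorParam_of_stationary`).

Conversely, any admissible `y` is a multiple of `E₂₂`, and `z_i = |z_i e₂⟩⟨e₂|`. Trace preservation
then gives `η = ‖z₁e₂‖² + ‖z₂e₂‖²`, whence (a). It also makes `E₂₂` an eigenvector of the dual
generator with eigenvalue `a - η`, so `ω(T_t E₂₂)` is exactly exponential, with a positive prefactor
unless `ω` is the absorbing state. Any other nonzero projection `p` has `⟨e₁, p e₁⟩ > 0`; as this is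
the limit of `ω(T_t p)`, the rate is `0`. -/

open MeasureTheory Set in
/-- A norm-continuous one-parameter semigroup in a Banach algebra is differentiable at `0`. -/
theorem exists_tendsto_slope_of_continuous_semigroup {A : Type*} [NormedRing A] [NormedAlgebra ℝ A]
    [CompleteSpace A] (F : ℝ≥0 → A) (hF : Continuous F) (h0 : F 0 = 1)
    (hadd : ∀ s t, F (s + t) = F s * F t) :
    ∃ L : A, Tendsto (fun t : ℝ≥0 => (t : ℝ)⁻¹ • (F t - 1)) (𝓝[>] 0) (𝓝 L) := by
  set G : ℝ → A := fun t => F t.toNNReal with hG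
  have hGc : Continuous G := hF.comp continuous_real_toNNReal
  have hG0 : G 0 = 1 := by simp [hG, h0]
  have hd : ∀ x : ℝ, HasDerivAt (fun t => ∫ s in (0 : ℝ)..t, G s) (G x) x := fun x =>
    intervalIntegral.integral_hasDerivAt_right (hGc.intervalIntegrable _ _)
      (hGc.stronglyMeasurableAtFilter _ _) hGc.continuousAt
  have hslope : ∀ x : ℝ, Tendsto (fun h : ℝ => h⁻¹ • ∫ s in x..(x + h), G s) (𝓝[>] 0)
      (𝓝 (G x)) := by
    intro x
    refine ((hd x).tendsto_slope_zero_right).congr fun h => ?_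
    rw [intervalIntegral.integral_interval_sub_left] <;> exact hGc.intervalIntegrable _ _
  -- Short-time averages of `G` tend to `1`, and the units are open.
  obtain ⟨δ, hδu, hδ⟩ : ∃ δ : ℝ, IsUnit (δ⁻¹ • ∫ s in (0 : ℝ)..(0 + δ), G s) ∧ 0 < δ := by
    have h1 : {a : A | IsUnit a} ∈ 𝓝 (G 0) := by
      rw [hG0]; exact Units.isOpen.mem_nhds isUnit_one
    exact (((hslope 0).eventually h1).and self_mem_nhdsWithin).exists
  rw [zero_add] at hδu
  obtain ⟨u, hu⟩ := hδu
  set I : A := ∫ s in (0 : ℝ)..δ, G s with hI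
  have hmul : ∀ h : ℝ≥0, F h * I = ∫ s in (h : ℝ)..(δ + h), G s := by
    intro h
    rw [hI, ← ContinuousLinearMap.mul_apply' ℝ A,
      ← ContinuousLinearMap.intervalIntegral_comp_comm _ (hGc.intervalIntegrable _ _)]
    rw [← zero_add (h : ℝ), ← add_assoc, ← intervalIntegral.integral_comp_add_right, add_zero]
    refine intervalIntegral.integral_congr fun s hs => ?_
    rw [uIcc_of_le hδ.le] at hs
    simp only [hG, ContinuousLinearMap.mul_apply']
    rw [Real.toNNReal_add hs.1 (by positivity), Real.toNNReal_coe, add_comm, hadd]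
  -- Multiplying by `I` turns the difference quotient of `F` into a difference of averages of `G`,
  -- which converge; invertibility of `I` then undoes the multiplication.
  have hkey : ∀ h : ℝ≥0, (h : ℝ)⁻¹ • (F h - 1) * I =
      (h : ℝ)⁻¹ • (∫ s in δ..(δ + h), G s) - (h : ℝ)⁻¹ • (∫ s in (0 : ℝ)..(0 + h), G s) := by
    intro h
    have hGi : ∀ a b : ℝ, IntervalIntegrable G volume a b := fun a b => hGc.intervalIntegrable a b
    rw [smul_mul_assoc, sub_mul, one_mul, hmul, ← smul_sub, zero_add]
    congr 1
    rw [hI, sub_eq_sub_iff_add_eq_add, add_comm,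
      intervalIntegral.integral_add_adjacent_intervals (hGi _ _) (hGi _ _),
      add_comm (∫ s in δ..(δ + h), G s),
      intervalIntegral.integral_add_adjacent_intervals (hGi _ _) (hGi _ _)]
  have hcoe : Tendsto (fun h : ℝ≥0 => (h : ℝ)) (𝓝[>] 0) (𝓝[>] 0) := by
    refine tendsto_nhdsWithin_iff.2 ⟨?_, ?_⟩
    · exact (NNReal.continuous_coe.tendsto' 0 0 rfl).mono_left nhdsWithin_le_nhds
    · filter_upwards [self_mem_nhdsWithin] with h hh
      exact NNReal.coe_pos.2 hh
  have hlim := (((hslope δ).comp hcoe).sub ((hslope 0).comp hcoe)).mul_const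
    (δ⁻¹ • (↑u⁻¹ : A))
  refine ⟨_, hlim.congr fun h => ?_⟩
  have hIu : I * (δ⁻¹ • (↑u⁻¹ : A)) = 1 := by
    rw [mul_smul_comm, ← smul_mul_assoc, ← hu, Units.mul_inv]
  simp only [Function.comp]
  rw [← hkey h, mul_assoc, hIu, mul_one]

/-! ### Positivity of block matrices -/

/-- The positive cone is generated by the elements `N* N`, on which the form equals `∑ₖ ‖∑ᵢ N k i
ξᵢ‖²`. -/
theorem sum_dotProduct_mulVec_nonneg (M : CStarMatrix (Fin 2) (Fin 2) M₂) (hM : 0 ≤ M)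
    (ξ : Fin 2 → Fin 2 → ℂ) : 0 ≤ ∑ i, ∑ j, star (ξ i) ⬝ᵥ M i j *ᵥ ξ j := by
  rw [StarOrderedRing.nonneg_iff] at hM
  induction hM using AddSubmonoid.closure_induction with
  | zero => simp
  | add x y _ _ hx hy =>
    simpa only [CStarMatrix.add_apply, Matrix.add_mulVec, dotProduct_add, Finset.sum_add_distrib]
      using add_nonneg hx hy
  | mem x hx =>
    obtain ⟨N, rfl⟩ := hx
    have hsum : ∑ i, ∑ j, star (ξ i) ⬝ᵥ (star N * N) i j *ᵥ ξ j
        = ∑ k, star (∑ i, N k i *ᵥ ξ i) ⬝ᵥ (∑ i, N k i *ᵥ ξ i) := by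
      simp only [CStarMatrix.mul_apply, CStarMatrix.star_apply, Matrix.star_eq_conjTranspose,
        star_sum, Matrix.sum_mulVec, dotProduct_sum, sum_dotProduct,
        Matrix.star_mulVec, Matrix.dotProduct_mulVec, ← Matrix.vecMul_vecMul, Matrix.sum_vecMul]
      rw [Finset.sum_comm_cycle]
      exact Finset.sum_congr rfl fun k _ => Finset.sum_comm
    change 0 ≤ ∑ i, ∑ j, star (ξ i) ⬝ᵥ (star N * N) i j *ᵥ ξ j
    rw [hsum]
    exact Finset.sum_nonneg fun k _ => dotProduct_star_self_nonneg _

/-- A completely positive map `φ` satisfies `∑ ⟨ξᵢ, φ (aᵢ* aⱼ) ξⱼ⟩ ≥ 0`. -/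
theorem sum_dotProduct_map_star_mul_nonneg (φ : M₂ →CP M₂) (a : Fin 2 → M₂)
    (ξ : Fin 2 → Fin 2 → ℂ) :
    0 ≤ ∑ i, ∑ j, star (ξ i) ⬝ᵥ φ (star (a i) * a j) *ᵥ ξ j := by
  -- With first row `a` and second row zero, `R* R` has entries `aᵢ* aⱼ`.
  let R : CStarMatrix (Fin 2) (Fin 2) M₂ := fun i j => if i = 0 then a j else 0
  have h := sum_dotProduct_mulVec_nonneg _
    (φ.map_cstarMatrix_nonneg _ (star_mul_self_nonneg R)) ξ
  have hent : ∀ i j, (star R * R).map φ i j = φ (star (a i) * a j) := by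
    intro i j
    have hR₀ : ∀ j, R 0 j = a j := fun _ => rfl
    have hR₁ : ∀ j, R 1 j = 0 := fun _ => rfl
    rw [CStarMatrix.map_apply, CStarMatrix.mul_apply]
    simp only [Fin.sum_univ_two, CStarMatrix.star_apply, hR₀, hR₁, mul_zero, add_zero]
  simpa only [hent] using h

/-- An affine function of a real variable that is bounded below is constant; real and imaginary `c`
give `A + B = 0` and `A - B = 0`. This expresses that a zero diagonal entry of a positive form kills
the off-diagonal ones. -/
theorem eq_zero_of_forall_nonneg_add {A B C : ℂ}
    (h : ∀ c : ℂ, 0 ≤ C + c * A + star c * B) : A = 0 ∧ B = 0 := by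
  have key : ∀ P : ℂ, (∀ r : ℝ, 0 ≤ C + r * P) → P = 0 := by
    intro P hP
    have hre : ∀ r : ℝ, 0 ≤ C.re + r * P.re ∧ 0 = C.im + r * P.im := fun r => by
      simpa [Complex.le_def] using hP r
    apply Complex.ext
    · by_contra hne
      have := (hre (-(C.re + 1) / P.re)).1
      rw [div_mul_cancel₀ _ hne] at this
      linarith
    · have h0 := (hre 0).2
      have h1 := (hre 1).2
      simp only [Complex.zero_im]
      linarith
  have h1 := key (A + B) fun r => by
    convert h r using 1
    simp [mul_add, add_assoc]
  have h2 := key (Complex.I * (A - B)) fun r => by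
    convert h (r * Complex.I) using 1
    simp
    ring
  have h3 : A - B = 0 := (mul_eq_zero.1 h2).resolve_left Complex.I_ne_zero
  constructor
  · linear_combination (h1 + h3) / 2
  · linear_combination (h1 - h3) / 2

/-! ### The predual semigroup -/

namespace QuantumMarkovSemigroup

variable (T : QuantumMarkovSemigroup)

theorem trace_predualMap_mul (t : ℝ≥0) (ρ x : M₂) :
    (T.predualMap t ρ * x).trace = (ρ * T.map t x).trace :=
  trace_traceDual_mul _ ρ x

theorem trace_predualMap (t : ℝ≥0) (ρ : M₂) : (T.predualMap t ρ).trace = ρ.trace := by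
  simpa [T.map_one] using T.trace_predualMap_mul t ρ 1

theorem predualMap_zero (ρ : M₂) : T.predualMap 0 ρ = ρ :=
  Matrix.ext_iff_trace_mul_right.2 fun x => by rw [trace_predualMap_mul, T.map_zero]

theorem predualMap_add (s t : ℝ≥0) (ρ : M₂) :
    T.predualMap (s + t) ρ = T.predualMap s (T.predualMap t ρ) :=
  Matrix.ext_iff_trace_mul_right.2 fun x => by
    rw [trace_predualMap_mul, trace_predualMap_mul, trace_predualMap_mul, add_comm s t, T.map_add]

theorem continuous_predualMap (ρ : M₂) : Continuous fun t => T.predualMap t ρ := by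
  refine continuous_matrix fun i j => ?_
  exact T.weakStar_continuous (functionalOf ρ) (Matrix.single j i 1)

theorem predualMap_conjTranspose (t : ℝ≥0) (ρ : M₂) :
    T.predualMap t ρᴴ = (T.predualMap t ρ)ᴴ := by
  refine Matrix.ext_iff_trace_mul_right.2 fun x => ?_
  have h : T.map t xᴴ = (T.map t x)ᴴ := map_star (T.map t) x
  have h' : T.map t x = (T.map t xᴴ)ᴴ := by rw [h, Matrix.conjTranspose_conjTranspose]
  rw [trace_predualMap_mul, h', ← Matrix.conjTranspose_mul, Matrix.trace_conjTranspose,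
    Matrix.trace_mul_comm, ← trace_predualMap_mul, ← Matrix.trace_conjTranspose,
    Matrix.conjTranspose_mul, Matrix.conjTranspose_conjTranspose, Matrix.trace_mul_comm]

/-- Complete positivity of the predual maps. -/
theorem sum_dotProduct_predualMap_nonneg (t : ℝ≥0) (ξ v : Fin 2 → Fin 2 → ℂ) :
    0 ≤ ∑ i, ∑ j, star (v j) ⬝ᵥ
      T.predualMap t (Matrix.vecMulVec (ξ j) (star (ξ i))) *ᵥ v i := by
  -- For `aᵢ = |f⟩⟨vᵢ|` with `f` a unit vector, `aᵢ* aⱼ = |vᵢ⟩⟨vⱼ|`.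
  have h := sum_dotProduct_map_star_mul_nonneg (T.map t)
    (fun i => Matrix.vecMulVec (Pi.single 0 1) (star (v i))) ξ
  have hdot : ∀ (u w : Fin 2 → ℂ) (x : M₂),
      star u ⬝ᵥ x *ᵥ w = (Matrix.vecMulVec w (star u) * x).trace := by
    intro u w x
    rw [Matrix.trace_mul_comm, Matrix.mul_vecMulVec, Matrix.trace_vecMulVec, dotProduct_comm]
  refine h.trans_eq (Finset.sum_congr rfl fun i _ => Finset.sum_congr rfl fun j _ => ?_)
  rw [hdot, hdot, Matrix.trace_mul_comm (Matrix.vecMulVec (v i) _), trace_predualMap_mul]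
  congr 3
  simp [Matrix.star_eq_conjTranspose, Matrix.conjTranspose_vecMulVec,
    Matrix.vecMulVec_mul_vecMulVec]

/-- The generator of the predual semigroup exists. -/
theorem exists_isGenerator_predualMap :
    ∃ L : M₂ →ₗ[ℂ] M₂, IsGenerator T.predualMap L := by
  obtain ⟨L, hL⟩ := exists_tendsto_slope_of_continuous_semigroup
    (A := M₂ →L[ℂ] M₂) (fun t => LinearMap.toContinuousLinearMap (T.predualMap t))
    (continuous_clm_apply.2 fun ρ => T.continuous_predualMap ρ)
    (by ext1 ρ; exact T.predualMap_zero ρ)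
    (fun s t => by ext1 ρ; exact T.predualMap_add s t ρ)
  exact ⟨L, fun ρ => ((ContinuousLinearMap.apply ℂ M₂ ρ).continuous.tendsto L).comp hL⟩

/-- An absorbing state is stationary. -/
theorem predualMap_eq_of_isAbsorbing {σ : M₂} (hT : T.IsAbsorbing (functionalOf σ)) (t : ℝ≥0) :
    T.predualMap t σ = σ := by
  refine Matrix.ext_iff_trace_mul_right.2 fun x => ?_
  rw [trace_predualMap_mul]
  -- Absorption is applied to the absorbing state itself, at `T_t x` and, along shifted times, at
  -- `x`; both limits are of the same function of `s`.
  have h1 := hT.2 _ hT.1 (T.map t x)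
  have h2 := (hT.2 _ hT.1 x).comp 
    (tendsto_atTop_mono (fun s : ℝ≥0 => (le_self_add : s ≤ s + t)) tendsto_id)
  refine tendsto_nhds_unique h1 (h2.congr fun s => ?_)
  change functionalOf σ (T.map (s + t) x) = functionalOf σ (T.map s (T.map t x))
  exact congrArg (functionalOf σ) (T.map_add s t x)

end QuantumMarkovSemigroup

open Matrix (vecMulVec)

/-! ### Orthonormal bases of `ℂ²` -/

/-- `e₁, e₂` is an orthonormal basis of `ℂ²`. -/
structure IsOrthonormalPair (e₁ e₂ : Fin 2 → ℂ) : Prop where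
  norm₁ : star e₁ ⬝ᵥ e₁ = 1
  norm₂ : star e₂ ⬝ᵥ e₂ = 1
  orth₁₂ : star e₁ ⬝ᵥ e₂ = 0

theorem trace_mul_ketBra (x : M₂) (v w : Fin 2 → ℂ) :
    (x * vecMulVec v (star w)).trace = star w ⬝ᵥ x *ᵥ v := by
  rw [Matrix.mul_vecMulVec, Matrix.trace_vecMulVec, dotProduct_comm]

theorem star_dotProduct_comm (v w : Fin 2 → ℂ) : star (star v ⬝ᵥ w) = star w ⬝ᵥ v := by
  rw [Matrix.star_dotProduct, star_star]

namespace IsOrthonormalPair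

variable {e₁ e₂ : Fin 2 → ℂ}

theorem orth₂₁ (he : IsOrthonormalPair e₁ e₂) : star e₂ ⬝ᵥ e₁ = 0 := by
  rw [← star_dotProduct_comm, he.orth₁₂, star_zero]

theorem ketBra_add_ketBra (he : IsOrthonormalPair e₁ e₂) : ketBra e₁ + ketBra e₂ = 1 := by
  have h : Matrix.of ![star e₁, star e₂] * (Matrix.of ![star e₁, star e₂])ᴴ = 1 := by
    have h₁ := he.norm₁
    have h₂ := he.norm₂
    have h₃ := he.orth₁₂
    have h₄ := he.orth₂₁
    simp only [dotProduct, Fin.sum_univ_two, Pi.star_apply, RCLike.star_def] at h₁ h₂ h₃ h₄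
    ext i j
    fin_cases i <;> fin_cases j <;> simpa [Matrix.mul_apply, Matrix.conjTranspose_apply]
  -- A right inverse of a square matrix is a left inverse, which turns orthonormality into
  -- completeness.
  have h' := mul_eq_one_comm.1 h
  rw [← h']
  ext i j
  simp [ketBra, Matrix.vecMulVec_apply, Matrix.mul_apply]

theorem vec_eq (he : IsOrthonormalPair e₁ e₂) (v : Fin 2 → ℂ) :
    v = (star e₁ ⬝ᵥ v) • e₁ + (star e₂ ⬝ᵥ v) • e₂ := by
  conv_lhs => rw [← Matrix.one_mulVec v, ← he.ketBra_add_ketBra]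
  simp only [Matrix.add_mulVec, ketBra, Matrix.vecMulVec_mulVec, op_smul_eq_smul]

theorem mat_eq (he : IsOrthonormalPair e₁ e₂) (x : M₂) :
    x = vecMulVec (x *ᵥ e₁) (star e₁) + vecMulVec (x *ᵥ e₂) (star e₂) := by
  conv_lhs => rw [← mul_one x, ← he.ketBra_add_ketBra]
  simp [mul_add, ketBra, Matrix.mul_vecMulVec]

theorem dotProduct_self (he : IsOrthonormalPair e₁ e₂) (v : Fin 2 → ℂ) :
    star v ⬝ᵥ v = ((‖star e₁ ⬝ᵥ v‖ ^ 2 + ‖star e₂ ⬝ᵥ v‖ ^ 2 : ℝ) : ℂ) := by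
  nth_rewrite 2 [he.vec_eq v]
  rw [dotProduct_add, dotProduct_smul, dotProduct_smul, ← star_dotProduct_comm e₁,
    ← star_dotProduct_comm e₂, smul_eq_mul, smul_eq_mul, RCLike.star_def,
    Complex.mul_conj', Complex.mul_conj']
  push_cast
  rfl

theorem linearMap_ext (he : IsOrthonormalPair e₁ e₂)
    {V : Type*} [AddCommGroup V] [Module ℂ V] {f g : M₂ →ₗ[ℂ] V}
    (h₁₁ : f (vecMulVec e₁ (star e₁)) = g (vecMulVec e₁ (star e₁)))
    (h₁₂ : f (vecMulVec e₁ (star e₂)) = g (vecMulVec e₁ (star e₂)))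
    (h₂₁ : f (vecMulVec e₂ (star e₁)) = g (vecMulVec e₂ (star e₁)))
    (h₂₂ : f (vecMulVec e₂ (star e₂)) = g (vecMulVec e₂ (star e₂))) : f = g := by
  ext1 x
  rw [he.mat_eq x, he.vec_eq (x *ᵥ e₁), he.vec_eq (x *ᵥ e₂)]
  simp only [Matrix.add_vecMulVec, Matrix.smul_vecMulVec, map_add, map_smul, h₁₁, h₁₂, h₂₁, h₂₂]

theorem eq_smul_ketBra (he : IsOrthonormalPair e₁ e₂)
    {x : M₂} (h : x *ᵥ e₁ = 0) (h' : xᴴ *ᵥ e₁ = 0) :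
    x = (star e₂ ⬝ᵥ x *ᵥ e₂) • ketBra e₂ := by
  have h₁ : star e₁ ⬝ᵥ x *ᵥ e₂ = 0 := by
    rw [Matrix.dotProduct_mulVec, ← Matrix.conjTranspose_conjTranspose x, ← Matrix.star_mulVec, h',
      star_zero, zero_dotProduct]
  conv_lhs => rw [he.mat_eq x, he.vec_eq (x *ᵥ e₂), h, h₁]
  simp [ketBra, Matrix.smul_vecMulVec]

/-- The only nonzero projection that vanishes on `e₁` is `|e₂⟩⟨e₂|`. -/
theorem eq_ketBra_of_isStarProjection (he : IsOrthonormalPair e₁ e₂)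
    {p : M₂} (hp : IsStarProjection p) (hp0 : p ≠ 0)
    (h : star e₁ ⬝ᵥ p *ᵥ e₁ = 0) : p = ketBra e₂ := by
  have hpH : pᴴ = p := hp.isSelfAdjoint
  have hpp : p * p = p := hp.isIdempotentElem
  -- For a projection, `‖p e₁‖² = ⟨e₁, p e₁⟩`.
  have h₁ : p *ᵥ e₁ = 0 := by
    rw [← dotProduct_star_self_eq_zero (v := p *ᵥ e₁), Matrix.star_mulVec,
      ← Matrix.dotProduct_mulVec, Matrix.mulVec_mulVec, hpH, hpp, h]
  have h₂ := he.eq_smul_ketBra h₁ (hpH.symm ▸ h₁)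
  set c := star e₂ ⬝ᵥ p *ᵥ e₂ with hc
  have hcc : c * c = c := by
    have : star e₂ ⬝ᵥ (p * p) *ᵥ e₂ = c := by rw [hpp]
    rw [h₂] at this
    simpa [ketBra, Matrix.vecMulVec_mul_vecMulVec, Matrix.smul_mulVec, Matrix.vecMulVec_mulVec,
      he.norm₂] using this
  have hc0 : c ≠ 0 := by
    rintro h0
    rw [h0, zero_smul] at h₂
    exact hp0 h₂
  rw [h₂, mul_right_cancel₀ hc0 (hcc.trans (one_mul c).symm), one_smul]

/-- A state that vanishes on `|e₂⟩⟨e₂|` is the pure state given by `e₁`. -/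
theorem state_eq_of_apply_ketBra_eq_zero (he : IsOrthonormalPair e₁ e₂)
    {ω : M₂ →ₗ[ℂ] ℂ} (hω : IsState ω)
    (h : ω (ketBra e₂) = 0) : ω = functionalOf (ketBra e₁) := by
  have h₁ : ω (ketBra e₁) = 1 := by
    have := hω.map_one
    rwa [← he.ketBra_add_ketBra, map_add, h, add_zero] at this
  -- Positivity is tested on `|e₁ + c e₂⟩⟨e₁ + c e₂|`, whose `|c|²` term vanishes by `h`.
  obtain ⟨h₂₁, h₁₂⟩ := eq_zero_of_forall_nonneg_add (A := ω (vecMulVec e₂ (star e₁)))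
    (B := ω (vecMulVec e₁ (star e₂))) (C := ω (ketBra e₁)) fun c => by
      have := hω.nonneg _ (Matrix.posSemidef_vecMulVec_self_star (e₁ + c • e₂)).nonneg
      refine this.trans_eq ?_
      have h' : ω (vecMulVec e₂ (star e₂)) = 0 := h
      simp only [star_add, star_smul, Matrix.add_vecMulVec, Matrix.vecMulVec_add,
        Matrix.smul_vecMulVec, Matrix.vecMulVec_smul, map_add, map_smul, smul_eq_mul, h', ketBra]
      ring
  have hf : ∀ v w : Fin 2 → ℂ, functionalOf (ketBra e₁) (vecMulVec v (star w))
      = star w ⬝ᵥ e₁ * (star e₁ ⬝ᵥ v) := by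
    intro v w
    change (ketBra e₁ * vecMulVec v (star w)).trace = _
    rw [trace_mul_ketBra, ketBra, Matrix.vecMulVec_mulVec, op_smul_eq_smul, dotProduct_smul,
      smul_eq_mul, mul_comm]
  apply he.linearMap_ext
  · rw [hf, he.norm₁, one_mul]; exact h₁
  · rw [hf, h₁₂, he.orth₂₁, zero_mul]
  · rw [hf, h₂₁, he.orth₁₂, mul_zero]
  · rw [hf, he.orth₁₂, mul_zero]; exact h

end IsOrthonormalPair

/-! ### Trace duality and evolution of dual eigenvectors -/

theorem functionalOf_surjective (ω : M₂ →ₗ[ℂ] ℂ) : ∃ ρ, functionalOf ρ = ω := by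
  refine ⟨Matrix.of fun i j => ω (Matrix.single j i 1), ?_⟩
  refine Matrix.ext_linearMap ℂ fun i j => LinearMap.ext_ring ?_
  change (Matrix.of (fun i j => ω (Matrix.single j i 1)) * Matrix.single i j 1).trace
    = ω (Matrix.single i j 1)
  rw [Matrix.trace_mul_single]
  simp

theorem jumpMap_apply (z : Fin 2 → M₂) (ρ : M₂) :
    jumpMap z ρ = ∑ i, z i * ρ * (z i)ᴴ := by
  simp [jumpMap]

theorem traceDual_jumpMap (z : Fin 2 → M₂) (x : M₂) :
    traceDual (jumpMap z) x = ∑ i, (z i)ᴴ * x * z i := by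
  refine Matrix.ext_iff_trace_mul_right.2 fun ρ => ?_
  rw [trace_traceDual_mul, jumpMap_apply, Finset.mul_sum, Finset.sum_mul, Matrix.trace_sum,
    Matrix.trace_sum]
  refine Finset.sum_congr rfl fun i _ => ?_
  rw [Matrix.mul_assoc (z i)ᴴ, Matrix.mul_assoc (z i)ᴴ, Matrix.trace_mul_comm (z i)ᴴ]
  simp only [Matrix.mul_assoc]

/-- If `x` is an eigenvector of the dual generator, then its expectations evolve exponentially. -/
theorem QuantumMarkovSemigroup.trace_predualMap_mul_eq_exp (T : QuantumMarkovSemigroup)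
    {L : M₂ → M₂} (hL : IsGenerator T.predualMap L) {x : M₂} {c : ℝ}
    (hx : ∀ σ, (L σ * x).trace = c * (σ * x).trace) (t : ℝ≥0) (ρ : M₂) :
    (T.predualMap t ρ * x).trace = Real.exp (c * t) * (ρ * x).trace := by
  have htr : Continuous fun σ : M₂ => (σ * x).trace := by fun_prop
  set u : ℝ → ℂ := fun s => (T.predualMap s.toNNReal ρ * x).trace with hu
  have huc : Continuous u :=
    htr.comp ((T.continuous_predualMap ρ).comp continuous_real_toNNReal)
  -- The generator is a limit over positive times, so only right derivatives are available; these
  -- suffice to show that `exp (-c s) u(s)` is constant.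
  have hud : ∀ s : ℝ, 0 ≤ s → HasDerivWithinAt u (c * u s) (Set.Ici s) s := by
    intro s hs
    rw [← hasDerivWithinAt_Ioi_iff_Ici, hasDerivWithinAt_iff_tendsto_slope' (by simp)]
    have hshift : Tendsto (fun r : ℝ => (r - s).toNNReal) (𝓝[>] s) (𝓝[>] 0) := by
      refine tendsto_nhdsWithin_iff.2 ⟨?_, ?_⟩
      · have : Continuous fun r : ℝ => (r - s).toNNReal := by fun_prop
        exact (this.tendsto' s 0 (by simp)).mono_left nhdsWithin_le_nhds
      · filter_upwards [self_mem_nhdsWithin] with r hr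
        exact Real.toNNReal_pos.2 (sub_pos.2 hr)
    have h := (htr.tendsto _).comp ((hL (T.predualMap s.toNNReal ρ)).comp hshift)
    rw [hx] at h
    refine h.congr' ?_
    filter_upwards [self_mem_nhdsWithin] with r hr
    have hrs : 0 ≤ r - s := (sub_pos.2 hr).le
    have hr' : r.toNNReal = (r - s).toNNReal + s.toNNReal := by
      rw [← Real.toNNReal_add hrs hs, sub_add_cancel]
    simp only [Function.comp, slope, vsub_eq_sub, hu]
    rw [hr', T.predualMap_add, Real.coe_toNNReal _ hrs, Matrix.smul_mul, Matrix.trace_smul,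
      Matrix.sub_mul, Matrix.trace_sub]
  have hg : ∀ s ∈ Set.Ico (0 : ℝ) (t + 1),
      HasDerivWithinAt (fun s : ℝ => (Real.exp (-(c * s)) : ℂ) * u s) 0 (Set.Ici s) s := by
    intro s hs
    have h1 : HasDerivAt (fun s : ℝ => Real.exp (-(c * s))) (Real.exp (-(c * s)) * -(c * 1)) s :=
      (((hasDerivAt_id s).const_mul c).neg).exp
    refine (h1.ofReal_comp.hasDerivWithinAt.mul (hud s hs.1)).congr_deriv ?_
    push_cast
    ring
  have hgc : Continuous (fun s : ℝ => (Real.exp (-(c * s)) : ℂ) * u s) := by fun_prop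
  have h := constant_of_has_deriv_right_zero hgc.continuousOn hg t
    ⟨t.2, by simp⟩
  simp only [hu, mul_zero, neg_zero, Real.exp_zero, Complex.ofReal_one, one_mul,
    Real.toNNReal_zero, T.predualMap_zero, Real.toNNReal_coe] at h
  rw [← h, ← mul_assoc, ← Complex.ofReal_mul, ← Real.exp_add, add_neg_cancel, Real.exp_zero,
    Complex.ofReal_one, one_mul]

theorem jumpMap_vecMulVec (v : Fin 2 → Fin 2 → ℂ) (e : Fin 2 → ℂ) (ρ : M₂) :
    jumpMap (fun i => vecMulVec (v i) (star e)) ρ = (star e ⬝ᵥ ρ *ᵥ e) • ∑ i, ketBra (v i) := by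
  rw [jumpMap_apply, Finset.smul_sum]
  refine Finset.sum_congr rfl fun i _ => ?_
  rw [Matrix.conjTranspose_vecMulVec, star_star, Matrix.vecMulVec_mul,
    Matrix.vecMulVec_mul_vecMulVec, ← Matrix.dotProduct_mulVec, Matrix.vecMulVec_smul, ketBra]

/-! ### Consequences of the form of the generator -/

namespace IsGeneratorParam

variable {T : QuantumMarkovSemigroup} {e₁ e₂ : Fin 2 → ℂ} {y : M₂} {z : Fin 2 → M₂}

theorem trace_generator (h : IsGeneratorParam T e₁ y z) (ρ : M₂) :
    (y * ρ + ρ * yᴴ + jumpMap z ρ).trace = 0 := by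
  have htr : Continuous fun σ : M₂ => σ.trace := by fun_prop
  have h1 := (htr.tendsto _).comp (h.generator ρ)
  refine tendsto_nhds_unique h1 (tendsto_const_nhds.congr fun t => ?_)
  simp [Matrix.trace_smul, Matrix.trace_sub, T.trace_predualMap]

theorem y_eq (he : IsOrthonormalPair e₁ e₂) (h : IsGeneratorParam T e₁ y z) :
    y = (star e₂ ⬝ᵥ y *ᵥ e₂) • ketBra e₂ :=
  he.eq_smul_ketBra h.y_mulVec h.y_conjTranspose_mulVec

theorem z_eq (he : IsOrthonormalPair e₁ e₂) (h : IsGeneratorParam T e₁ y z) (i : Fin 2) :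
    z i = vecMulVec (z i *ᵥ e₂) (star e₂) := by
  conv_lhs => rw [he.mat_eq (z i), h.z_mulVec i]
  rw [Matrix.zero_vecMulVec, zero_add]

theorem jumpMap_eq (he : IsOrthonormalPair e₁ e₂) (h : IsGeneratorParam T e₁ y z) (ρ : M₂) :
    jumpMap z ρ = (star e₂ ⬝ᵥ ρ *ᵥ e₂) • ∑ i, ketBra (z i *ᵥ e₂) := by
  conv_lhs => rw [show z = fun i => vecMulVec (z i *ᵥ e₂) (star e₂) from funext (h.z_eq he)]
  exact jumpMap_vecMulVec _ _ _

/-- Trace preservation at `|e₂⟩⟨e₂|`: the loss through `y` balances the gain through the jumps. -/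
theorem neg_add_conjTranspose (he : IsOrthonormalPair e₁ e₂) (h : IsGeneratorParam T e₁ y z) :
    -(star e₂ ⬝ᵥ y *ᵥ e₂ + star (star e₂ ⬝ᵥ y *ᵥ e₂)) =
      ∑ i, star (z i *ᵥ e₂) ⬝ᵥ (z i *ᵥ e₂) := by
  have h1 := h.trace_generator (ketBra e₂)
  rw [h.jumpMap_eq he, h.y_eq he] at h1
  simp only [ketBra, Matrix.conjTranspose_smul, Matrix.conjTranspose_vecMulVec, star_star,
    Matrix.smul_mul, Matrix.mul_smul, Matrix.vecMulVec_mul_vecMulVec, he.norm₂, one_smul,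
    Matrix.trace_add, Matrix.trace_smul, Matrix.trace_vecMulVec, Matrix.trace_sum,
    Matrix.vecMulVec_mulVec, op_smul_eq_smul, smul_eq_mul, mul_one,
    dotProduct_comm e₂ (star e₂)] at h1
  simp only [dotProduct_comm (star (z _ *ᵥ e₂))]
  linear_combination -h1

end IsGeneratorParam

/-- The total exit rate `‖z₁ e₂‖² + ‖z₂ e₂‖²`. -/
noncomputable def rateTotal (z : Fin 2 → M₂) (e₁ e₂ : Fin 2 → ℂ) : ℝ :=
  ∑ i, (‖star e₁ ⬝ᵥ z i *ᵥ e₂‖ ^ 2 + ‖star e₂ ⬝ᵥ z i *ᵥ e₂‖ ^ 2)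

theorem rateA_eq (z : Fin 2 → M₂) (e₂ : Fin 2 → ℂ) :
    rateA z e₂ = ∑ i, ‖star e₂ ⬝ᵥ z i *ᵥ e₂‖ ^ 2 := by
  refine Finset.sum_congr rfl fun i _ => ?_
  rw [← star_dotProduct_comm, norm_star]

theorem rateTotal_sub_rateA (z : Fin 2 → M₂) (e₁ e₂ : Fin 2 → ℂ) :
    rateTotal z e₁ e₂ - rateA z e₂ = ∑ i, ‖star e₁ ⬝ᵥ z i *ᵥ e₂‖ ^ 2 := by
  rw [rateTotal, rateA_eq, Finset.sum_add_distrib, add_sub_cancel_right]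

namespace IsGeneratorParam

variable {T : QuantumMarkovSemigroup} {e₁ e₂ : Fin 2 → ℂ} {y : M₂} {z : Fin 2 → M₂}

theorem neg_add_conj_eq_rateTotal (he : IsOrthonormalPair e₁ e₂) (h : IsGeneratorParam T e₁ y z) :
    -(star e₂ ⬝ᵥ y *ᵥ e₂ + star (star e₂ ⬝ᵥ y *ᵥ e₂)) = (rateTotal z e₁ e₂ : ℂ) := by
  rw [h.neg_add_conjTranspose he, rateTotal, Complex.ofReal_sum]
  exact Finset.sum_congr rfl fun i _ => he.dotProduct_self _

/-- Here `-(y + y*)` is `rateTotal` times `|e₂⟩⟨e₂|`, with eigenvalues `rateTotal ≥ 0` and `0`. -/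
theorem isRateEta (he : IsOrthonormalPair e₁ e₂) (h : IsGeneratorParam T e₁ y z) :
    IsRateEta y (rateTotal z e₁ e₂) := by
  have hy : -(y + yᴴ) = (rateTotal z e₁ e₂ : ℂ) • ketBra e₂ := by
    rw [← h.neg_add_conj_eq_rateTotal he]
    conv_lhs => rw [h.y_eq he]
    rw [Matrix.conjTranspose_smul, ketBra, Matrix.conjTranspose_vecMulVec, star_star, ← add_smul,
      ← neg_smul]
  have hmul : ∀ v, -(y + yᴴ) *ᵥ v = ((rateTotal z e₁ e₂ : ℂ) * (star e₂ ⬝ᵥ v)) • e₂ := by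
    intro v
    rw [hy, Matrix.smul_mulVec, ketBra, Matrix.vecMulVec_mulVec, op_smul_eq_smul, smul_smul]
  constructor
  · refine Module.End.hasEigenvalue_of_hasEigenvector (x := e₂) ?_
    rw [Module.End.hasEigenvector_iff, Module.End.mem_eigenspace_iff]
    refine ⟨?_, fun h0 => ?_⟩
    · rw [Matrix.toLin'_apply, hmul, he.norm₂, mul_one]
    · have := he.norm₂
      simp [h0] at this
  · intro r hr
    obtain ⟨v, hv⟩ := hr.exists_hasEigenvector
    rw [Module.End.hasEigenvector_iff, Module.End.mem_eigenspace_iff, Matrix.toLin'_apply,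
      hmul] at hv
    obtain ⟨hv, hv0⟩ := hv
    have hη : 0 ≤ rateTotal z e₁ e₂ := Finset.sum_nonneg fun i _ => by positivity
    by_cases hr0 : r = 0
    · rwa [hr0]
    have h₂ := congrArg (fun w => star e₂ ⬝ᵥ w) hv
    have h₁ := congrArg (fun w => star e₁ ⬝ᵥ w) hv
    simp only [dotProduct_smul, he.orth₁₂, he.norm₂, smul_eq_mul, mul_zero, mul_one] at h₁ h₂
    have h₁' : star e₁ ⬝ᵥ v = 0 := by simpa [hr0] using h₁.symm
    have h₂' : star e₂ ⬝ᵥ v ≠ 0 := by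
      intro h0
      apply hv0
      rw [he.vec_eq v, h₁', h0]
      simp
    exact (Complex.ofReal_injective (mul_right_cancel₀ h₂' h₂)).ge

/-- Each `z_i* |e₁⟩⟨e₁| z_i` is `|⟨e₁, z_i e₂⟩|² |e₂⟩⟨e₂|`, the part of `‖z_i e₂‖²` not counted by
`a`. -/
theorem traceDual_jumpMap_ketBra (he : IsOrthonormalPair e₁ e₂) (h : IsGeneratorParam T e₁ y z) :
    traceDual (jumpMap z) (ketBra e₁) = (rateTotal z e₁ e₂ - rateA z e₂) • ketBra e₂ := by
  rw [traceDual_jumpMap, rateTotal_sub_rateA, Finset.sum_smul]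
  refine Finset.sum_congr rfl fun i _ => ?_
  have hz := h.z_eq he i
  set v := z i *ᵥ e₂
  rw [hz, ketBra, ketBra, Matrix.conjTranspose_vecMulVec, star_star,
    Matrix.vecMulVec_mul_vecMulVec, Matrix.vecMulVec_smul, Matrix.smul_mul,
    Matrix.vecMulVec_mul_vecMulVec, Matrix.vecMulVec_smul, smul_smul, ← star_dotProduct_comm,
    ← Complex.coe_smul, RCLike.star_def, Complex.conj_mul']
  push_cast
  rfl

/-- The eigenvector property behind the exact exponential law: the `y` terms remove mass from `e₂`
at rate `rateTotal`, and the jumps return it at rate `a`. -/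
theorem trace_generator_mul_ketBra (he : IsOrthonormalPair e₁ e₂) (h : IsGeneratorParam T e₁ y z)
    (σ : M₂) : ((y * σ + σ * yᴴ + jumpMap z σ) * ketBra e₂).trace =
      ((rateA z e₂ - rateTotal z e₁ e₂ : ℝ) : ℂ) * (σ * ketBra e₂).trace := by
  have hA : (rateA z e₂ : ℂ) = ∑ i, star e₂ ⬝ᵥ ketBra (z i *ᵥ e₂) *ᵥ e₂ := by
    rw [rateA_eq, Complex.ofReal_sum]
    refine Finset.sum_congr rfl fun i _ => ?_
    rw [ketBra, Matrix.vecMulVec_mulVec, op_smul_eq_smul, dotProduct_smul, smul_eq_mul,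
      ← star_dotProduct_comm e₂, RCLike.star_def, Complex.conj_mul']
    push_cast
    rfl
  have hy₁ : star e₂ ⬝ᵥ (y * σ) *ᵥ e₂ = (star e₂ ⬝ᵥ y *ᵥ e₂) * (star e₂ ⬝ᵥ σ *ᵥ e₂) := by
    conv_lhs => rw [h.y_eq he]
    rw [Matrix.smul_mul, Matrix.smul_mulVec, dotProduct_smul, smul_eq_mul, ketBra,
      ← Matrix.mulVec_mulVec, Matrix.vecMulVec_mulVec, op_smul_eq_smul, dotProduct_smul, he.norm₂]
    simp
  have hy₂ : star e₂ ⬝ᵥ (σ * yᴴ) *ᵥ e₂ =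
      star (star e₂ ⬝ᵥ y *ᵥ e₂) * (star e₂ ⬝ᵥ σ *ᵥ e₂) := by
    conv_lhs => rw [h.y_eq he]
    rw [Matrix.conjTranspose_smul, Matrix.mul_smul, Matrix.smul_mulVec, dotProduct_smul,
      smul_eq_mul, ketBra, Matrix.conjTranspose_vecMulVec, star_star,
      ← Matrix.mulVec_mulVec, Matrix.vecMulVec_mulVec, he.norm₂]
    simp
  rw [ketBra, trace_mul_ketBra, trace_mul_ketBra, Matrix.add_mulVec, Matrix.add_mulVec,
    dotProduct_add, dotProduct_add, hy₁, hy₂, h.jumpMap_eq he, Matrix.smul_mulVec,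
    Matrix.sum_mulVec, dotProduct_smul, dotProduct_sum, ← hA, smul_eq_mul, Complex.ofReal_sub,
    ← h.neg_add_conj_eq_rateTotal he]
  ring

end IsGeneratorParam

/-! ### Semigroups with a stationary pure state -/

section Stationary

variable {T : QuantumMarkovSemigroup} {e₁ e₂ : Fin 2 → ℂ}

/-- If the pure state given by `e₁` is stationary, then `|e₂⟩⟨e₁|` is an eigenvector. -/
theorem predualMap_vecMulVec_of_stationary (he : IsOrthonormalPair e₁ e₂)
    (hst : ∀ t, T.predualMap t (ketBra e₁) = ketBra e₁) (t : ℝ≥0) :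
    T.predualMap t (vecMulVec e₂ (star e₁)) =
      (star e₂ ⬝ᵥ T.predualMap t (vecMulVec e₂ (star e₁)) *ᵥ e₁) • vecMulVec e₂ (star e₁) := by
  set X := T.predualMap t (vecMulVec e₂ (star e₁)) with hX
  have h₂ : X *ᵥ e₂ = 0 := by
    rw [← dotProduct_star_self_eq_zero]
    -- With test vectors `c e₂` and `X e₂`, the `|c|²` term is `⟨e₂, E₁₁ e₂⟩ = 0`, and the
    -- coefficient of `c` is `‖X e₂‖²`.
    have h := (eq_zero_of_forall_nonneg_add (A := star (X *ᵥ e₂) ⬝ᵥ X *ᵥ e₂)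
      (B := star e₂ ⬝ᵥ T.predualMap t (vecMulVec e₁ (star e₂)) *ᵥ (X *ᵥ e₂))
      (C := star (X *ᵥ e₂) ⬝ᵥ T.predualMap t (vecMulVec e₂ (star e₂)) *ᵥ (X *ᵥ e₂))
      fun c => by
        have h := T.sum_dotProduct_predualMap_nonneg t ![e₁, e₂] ![c • e₂, X *ᵥ e₂]
        have h0 : T.predualMap t (vecMulVec e₁ (star e₁)) = vecMulVec e₁ (star e₁) := hst t
        refine h.trans_eq ?_
        simp only [Fin.sum_univ_two, Matrix.cons_val_zero, Matrix.cons_val_one, h0,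
          Matrix.vecMulVec_mulVec, dotProduct_smul, he.orth₁₂, Matrix.mulVec_smul, star_smul,
          smul_dotProduct, smul_eq_mul, op_smul_eq_smul, ← hX]
        ring).1
    simpa using h
  have hmat : X = vecMulVec (X *ᵥ e₁) (star e₁) := by
    conv_lhs => rw [he.mat_eq X, h₂, Matrix.zero_vecMulVec, add_zero]
  have htr : star e₁ ⬝ᵥ X *ᵥ e₁ = 0 := by
    have h := T.trace_predualMap t (vecMulVec e₂ (star e₁))
    rw [← hX, hmat, Matrix.trace_vecMulVec, Matrix.trace_vecMulVec, dotProduct_comm,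
      dotProduct_comm e₂, he.orth₁₂] at h
    exact h
  conv_lhs => rw [hmat, he.vec_eq (X *ᵥ e₁), htr]
  rw [zero_smul, zero_add, Matrix.smul_vecMulVec]

/-- If the pure state given by `e₁` is stationary, then `T_t(|e₂⟩⟨e₂|)` dominates a multiple of
`|e₂⟩⟨e₂|`. -/
theorem dotProduct_predualMap_ge_of_stationary (he : IsOrthonormalPair e₁ e₂)
    (hst : ∀ t, T.predualMap t (ketBra e₁) = ketBra e₁) (t : ℝ≥0) {w : ℂ}
    (hw : T.predualMap t (vecMulVec e₂ (star e₁)) = w • vecMulVec e₂ (star e₁))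
    (v : Fin 2 → ℂ) :
    0 ≤ star v ⬝ᵥ T.predualMap t (ketBra e₂) *ᵥ v
      - w * star w * (star v ⬝ᵥ ketBra e₂ *ᵥ v) := by
  have hw' : T.predualMap t (vecMulVec e₁ (star e₂)) = star w • vecMulVec e₁ (star e₂) := by
    have h := T.predualMap_conjTranspose t (vecMulVec e₂ (star e₁))
    rwa [hw, Matrix.conjTranspose_smul, Matrix.conjTranspose_vecMulVec, star_star] at h
  -- The multiple of `e₁` minimizes the quadratic form when the other test vector is `v`, as in a
  -- Schur complement.
  have h := T.sum_dotProduct_predualMap_nonneg t ![e₁, e₂]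
    ![-(star (w * (star v ⬝ᵥ e₂))) • e₁, v]
  have h0 : T.predualMap t (vecMulVec e₁ (star e₁)) = vecMulVec e₁ (star e₁) := hst t
  refine h.trans_eq ?_
  simp only [Fin.sum_univ_two, Matrix.cons_val_zero, Matrix.cons_val_one, h0, hw, hw', ketBra,
    Matrix.vecMulVec_mulVec, dotProduct_smul, he.norm₁, Matrix.mulVec_smul, star_smul,
    smul_dotProduct, smul_eq_mul, op_smul_eq_smul, Matrix.smul_mulVec, star_neg, star_star,
    star_mul', star_dotProduct_comm]
  ring

/-- The generator of a semigroup with a stationary pure state has the stated form. -/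
theorem exists_isGeneratorParam_of_stationary (he : IsOrthonormalPair e₁ e₂)
    (hst : ∀ t, T.predualMap t (ketBra e₁) = ketBra e₁) :
    ∃ (y : M₂) (z : Fin 2 → M₂), IsGeneratorParam T e₁ y z := by
  obtain ⟨L, hL⟩ := T.exists_isGenerator_predualMap
  have hLstar : ∀ ρ, L ρᴴ = (L ρ)ᴴ := by
    intro ρ
    have hc : Continuous fun σ : M₂ => σᴴ := by fun_prop
    refine tendsto_nhds_unique (hL ρᴴ) (((hc.tendsto _).comp (hL ρ)).congr fun t => ?_)
    simp [Matrix.conjTranspose_smul, T.predualMap_conjTranspose]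
  have hcoord : ∀ u v : Fin 2 → ℂ, Continuous fun σ : M₂ => star u ⬝ᵥ σ *ᵥ v := by
    intro u v
    fun_prop
  set w : ℝ≥0 → ℂ := fun t => star e₂ ⬝ᵥ T.predualMap t (vecMulVec e₂ (star e₁)) *ᵥ e₁ with hwdef
  have hw : ∀ t, T.predualMap t (vecMulVec e₂ (star e₁)) = w t • vecMulVec e₂ (star e₁) :=
    predualMap_vecMulVec_of_stationary he hst
  have hE₂₁ : star e₂ ⬝ᵥ vecMulVec e₂ (star e₁) *ᵥ e₁ = 1 := by
    rw [Matrix.vecMulVec_mulVec, he.norm₁]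
    simpa using he.norm₂
  have hw1 : Tendsto w (𝓝[>] 0) (𝓝 1) := by
    have : Continuous w := (hcoord e₂ e₁).comp (T.continuous_predualMap _)
    refine (this.tendsto' 0 1 ?_).mono_left nhdsWithin_le_nhds
    simp only [hwdef, T.predualMap_zero, hE₂₁]
  set κ : ℂ := star e₂ ⬝ᵥ L (vecMulVec e₂ (star e₁)) *ᵥ e₁ with hκ
  have hwκ : Tendsto (fun t : ℝ≥0 => (t : ℝ)⁻¹ • (w t - 1)) (𝓝[>] 0) (𝓝 κ) := by
    refine (((hcoord e₂ e₁).tendsto _).comp (hL (vecMulVec e₂ (star e₁)))).congr fun t => ?_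
    simp only [Function.comp, Matrix.smul_mulVec, dotProduct_smul, Matrix.sub_mulVec,
      dotProduct_sub, hE₂₁, hwdef]
  have hL₁₁ : L (vecMulVec e₁ (star e₁)) = 0 := by
    refine tendsto_nhds_unique (hL _) (tendsto_const_nhds.congr fun t => ?_)
    rw [show T.predualMap t (vecMulVec e₁ (star e₁)) = vecMulVec e₁ (star e₁) from hst t,
      sub_self, smul_zero]
  have hL₂₁ : L (vecMulVec e₂ (star e₁)) = κ • vecMulVec e₂ (star e₁) := by
    refine tendsto_nhds_unique (hL _) ((hwκ.smul_const _).congr fun t => ?_)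
    rw [hw t, smul_assoc, sub_smul, one_smul]
  have hL₁₂ : L (vecMulVec e₁ (star e₂)) = star κ • vecMulVec e₁ (star e₂) := by
    have h := hLstar (vecMulVec e₂ (star e₁))
    rwa [hL₂₁, Matrix.conjTranspose_smul, Matrix.conjTranspose_vecMulVec, star_star] at h
  -- Once `y = κ |e₂⟩⟨e₂|` is fixed by the off-diagonal units, `C` is what the jump part must yield
  -- at `|e₂⟩⟨e₂|`.
  set C : M₂ := L (ketBra e₂) - (κ + star κ) • ketBra e₂ with hC
  have hww : Tendsto (fun t : ℝ≥0 => (t : ℝ)⁻¹ • (w t * star (w t) - 1)) (𝓝[>] 0)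
      (𝓝 (κ + star κ)) := by
    have h1 : Tendsto (fun t => star (w t)) (𝓝[>] 0) (𝓝 1) := by
      have h := (continuous_star.tendsto _).comp hw1
      rwa [star_one] at h
    have h2 := (hwκ.mul h1).add ((continuous_star.tendsto _).comp hwκ)
    rw [mul_one] at h2
    refine h2.congr fun t => ?_
    have h3 : star ((t : ℝ)⁻¹ • (w t - 1)) = (t : ℝ)⁻¹ • (star (w t) - 1) := by
      rw [star_smul, star_sub, star_one, star_trivial]
    rw [Function.comp_apply, h3]
    simp only [Complex.real_smul]
    ring
  have hCpos : 0 ≤ C := by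
    rw [Matrix.nonneg_iff_posSemidef]
    refine Matrix.PosSemidef.of_dotProduct_mulVec_nonneg ?_ fun v => ?_
    · have hk : (ketBra e₂)ᴴ = ketBra e₂ := by
        rw [ketBra, Matrix.conjTranspose_vecMulVec, star_star]
      have hLk : (L (ketBra e₂))ᴴ = L (ketBra e₂) := by rw [← hLstar, hk]
      rw [Matrix.IsHermitian, hC, Matrix.conjTranspose_sub, Matrix.conjTranspose_smul, hk, hLk,
        star_add, star_star, add_comm (star κ)]
    · have h1 := ((hcoord v v).tendsto _).comp (hL (ketBra e₂))
      have h2 := h1.sub (hww.mul_const (star v ⬝ᵥ ketBra e₂ *ᵥ v))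
      have h3 : star v ⬝ᵥ C *ᵥ v = star v ⬝ᵥ L (ketBra e₂) *ᵥ v
          - (κ + star κ) * (star v ⬝ᵥ ketBra e₂ *ᵥ v) := by
        rw [hC, Matrix.sub_mulVec, dotProduct_sub, Matrix.smul_mulVec, dotProduct_smul,
          smul_eq_mul]
      rw [h3]
      -- The domination `T_t(E₂₂) ≥ |w(t)|² E₂₂` is an equality at `t = 0`, so it may be divided by
      -- `t` and passed to the limit.
      refine ge_of_tendsto' h2 fun t => ?_
      have h4 := dotProduct_predualMap_ge_of_stationary he hst t (hw t) v
      have h5 : (0 : ℂ) ≤ (((t : ℝ)⁻¹ : ℝ) : ℂ) := by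
        rw [Complex.zero_le_real]
        positivity
      refine (mul_nonneg h5 h4).trans_eq ?_
      simp only [Function.comp, Matrix.smul_mulVec, dotProduct_smul, Matrix.sub_mulVec,
        dotProduct_sub, Complex.real_smul]
      ring
  obtain ⟨v, hsum⟩ : ∃ v : Fin 2 → Fin 2 → ℂ, ∑ i, vecMulVec (v i) (star (v i)) = C := by
    -- The two conjugated rows of `b` in `C = b* b` serve as the vectors, which is why two jump
    -- operators suffice.
    obtain ⟨b, hb⟩ := CStarAlgebra.nonneg_iff_eq_star_mul_self.1 hCpos
    refine ⟨fun i k => star (b i k), ?_⟩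
    rw [hb]
    ext k l
    simp [Matrix.sum_apply, Matrix.vecMulVec_apply, Matrix.mul_apply, Matrix.star_apply]
  refine ⟨κ • ketBra e₂, fun i => vecMulVec (v i) (star e₂), ?_, ?_, ?_, fun i => ?_⟩
  · have hlin : L = LinearMap.mulLeft ℂ (κ • ketBra e₂) + LinearMap.mulRight ℂ (κ • ketBra e₂)ᴴ
        + jumpMap fun i => vecMulVec (v i) (star e₂) := by
      apply he.linearMap_ext <;>
      simp only [LinearMap.add_apply, LinearMap.mulLeft_apply, LinearMap.mulRight_apply,
        jumpMap_vecMulVec, hsum, hL₁₁, hL₁₂, hL₂₁, ketBra, Matrix.conjTranspose_smul,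
        Matrix.conjTranspose_vecMulVec, star_star, Matrix.smul_mul, Matrix.mul_smul,
        Matrix.vecMulVec_mul_vecMulVec, Matrix.vecMulVec_mulVec, he.norm₂, he.orth₁₂,
        he.orth₂₁, zero_smul, one_smul, smul_zero, zero_add, add_zero, Matrix.vecMulVec_zero,
        dotProduct_zero, MulOpposite.op_zero, MulOpposite.op_one]
      rw [hC, ketBra, add_smul]
      abel
    intro ρ
    have h := hL ρ
    rw [hlin] at h
    exact h
  · rw [Matrix.smul_mulVec, ketBra, Matrix.vecMulVec_mulVec, he.orth₂₁]
    simp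
  · rw [Matrix.conjTranspose_smul, Matrix.smul_mulVec, ketBra, Matrix.conjTranspose_vecMulVec,
      star_star, Matrix.vecMulVec_mulVec, he.orth₂₁]
    simp
  · rw [Matrix.vecMulVec_mulVec, he.orth₂₁]
    simp

end Stationary

/-! ### Asymptotics of the occupation probabilities -/

theorem tendsto_one_div_mul_log_of_tendsto {f : ℝ≥0 → ℝ} {c : ℝ} (hc : 0 < c)
    (hf : Tendsto f atTop (𝓝 c)) :
    Tendsto (fun t : ℝ≥0 => 1 / (t : ℝ) * Real.log (f t)) atTop (𝓝 0) := by
  have h1 : Tendsto (fun t : ℝ≥0 => 1 / (t : ℝ)) atTop (𝓝 0) := by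
    simpa only [one_div, Function.comp_def, id] using
      tendsto_inv_atTop_zero.comp (NNReal.tendsto_coe_atTop.2 tendsto_id)
  simpa using h1.mul (hf.log hc.ne')

theorem tendsto_one_div_mul_log_exp_mul {q c : ℝ} (hc : 0 < c) :
    Tendsto (fun t : ℝ≥0 => 1 / (t : ℝ) * Real.log (Real.exp (q * t) * c)) atTop (𝓝 q) := by
  have h := (tendsto_one_div_mul_log_of_tendsto hc tendsto_const_nhds).const_add q
  rw [add_zero] at h
  refine h.congr' ?_
  filter_upwards [eventually_gt_atTop 0] with t ht
  have ht' : (t : ℝ) ≠ 0 := by exact_mod_cast ht.ne'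
  rw [Real.log_mul (Real.exp_pos _).ne' hc.ne', Real.log_exp]
  field_simp

end QuantumMarkov

theorem mainTheorem3 (T : QuantumMarkovSemigroup) (e₁ e₂ : Fin 2 → ℂ)
    (he₁ : star e₁ ⬝ᵥ e₁ = 1) (he₂ : star e₂ ⬝ᵥ e₂ = 1) (he₁₂ : star e₁ ⬝ᵥ e₂ = 0)
    (hT : T.IsAbsorbing (functionalOf (ketBra e₁))) :
    (∃ (y : M₂) (z : Fin 2 → M₂), IsGeneratorParam T e₁ y z) ∧
    ∀ (y : M₂) (z : Fin 2 → M₂), IsGeneratorParam T e₁ y z →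
      ∃ η : ℝ, IsRateEta y η ∧
        traceDual (jumpMap z) (ketBra e₁) = (η - rateA z e₂) • ketBra e₂ ∧
        ∀ ω : M₂ →ₗ[ℂ] ℂ, IsState ω → ω ≠ functionalOf (ketBra e₁) →
          ∀ p : M₂, IsStarProjection p → p ≠ 0 →
            (∀ᶠ t : ℝ≥0 in atTop, 0 < ω (T.map t p)) ∧
            (p = ketBra e₂ →
              Tendsto (fun t : ℝ≥0 => 1 / (t : ℝ) * Real.log (ω (T.map t p)).re) atTop
                (𝓝 (rateA z e₂ - η))) ∧
            (p ≠ ketBra e₂ →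
              Tendsto (fun t : ℝ≥0 => 1 / (t : ℝ) * Real.log (ω (T.map t p)).re) atTop
                (𝓝 0)) := by
  have he : IsOrthonormalPair e₁ e₂ := ⟨he₁, he₂, he₁₂⟩
  refine ⟨exists_isGeneratorParam_of_stationary he (T.predualMap_eq_of_isAbsorbing hT),
    fun y z h => ⟨rateTotal z e₁ e₂, h.isRateEta he, h.traceDual_jumpMap_ketBra he, ?_⟩⟩
  intro ω hω hne p hp hp0
  by_cases hpe : p = ketBra e₂
  · subst hpe
    -- This is where `ω` must differ from the absorbing state: otherwise the prefactor of the
    -- exponential vanishes.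
    have hpos : 0 < ω (ketBra e₂) := by
      refine lt_of_le_of_ne (hω.nonneg _ hp.nonneg) fun h0 => hne ?_
      exact he.state_eq_of_apply_ketBra_eq_zero hω h0.symm
    have hexp : ∀ t : ℝ≥0, ω (T.map t (ketBra e₂)) =
        Real.exp ((rateA z e₂ - rateTotal z e₁ e₂) * t) * ω (ketBra e₂) := by
      obtain ⟨ρ, rfl⟩ := functionalOf_surjective ω
      intro t
      have h1 := T.trace_predualMap_mul_eq_exp h.generator (h.trace_generator_mul_ketBra he) t ρ
      rwa [T.trace_predualMap_mul] at h1
    refine ⟨Eventually.of_forall fun t => ?_, fun _ => ?_, fun h0 => absurd rfl h0⟩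
    · rw [hexp]
      exact mul_pos (Complex.zero_lt_real.2 (Real.exp_pos _)) hpos
    · simp only [hexp, Complex.re_ofReal_mul]
      exact tendsto_one_div_mul_log_exp_mul (Complex.pos_iff.1 hpos).1
  · have hlim : Tendsto (fun t => ω (T.map t p)) atTop (𝓝 (star e₁ ⬝ᵥ p *ᵥ e₁)) := by
      have h1 := hT.2 ω hω p
      have h2 : functionalOf (ketBra e₁) p = star e₁ ⬝ᵥ p *ᵥ e₁ := by
        rw [← trace_mul_ketBra, Matrix.trace_mul_comm]
        rfl
      rwa [h2] at h1
    -- A zero limit would force `p` to be `|e₂⟩⟨e₂|`.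
    have hpos : 0 < star e₁ ⬝ᵥ p *ᵥ e₁ :=
      lt_of_le_of_ne ((Matrix.nonneg_iff_posSemidef.1 hp.nonneg).dotProduct_mulVec_nonneg e₁)
        fun h0 => hpe (he.eq_ketBra_of_isStarProjection hp hp0 h0.symm)
    have hre : 0 < (star e₁ ⬝ᵥ p *ᵥ e₁).re := (Complex.pos_iff.1 hpos).1
    have hlimre := (Complex.continuous_re.tendsto _).comp hlim
    refine ⟨?_, fun h0 => absurd h0 hpe, fun _ => tendsto_one_div_mul_log_of_tendsto hre hlimre⟩
    filter_upwards [hlimre.eventually (lt_mem_nhds hre)] with t ht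
    have hnn : 0 ≤ ω (T.map t p) := hω.nonneg _ (map_nonneg (T.map t) hp.nonneg)
    exact Complex.pos_iff.2 ⟨ht, (Complex.nonneg_iff.1 hnn).2⟩
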